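/- Let $\mu$ be a probability measure on a discrete group $\Gamma$ with identity $e$, and assume that $\mu$ is generating, i.e. the semigroup generated by $\{g\in\Gamma:\mu(g)>0\}$ is $\Gamma$. Let $h_1,h_2,\dots$ be independent $\mu$-distributed elements of $\Gamma$, and let $\mathbf P$ be the law on path space of the random walk $\boldsymbol x=(x_n)_{n\ge0}$, where $x_0=e$ and $x_n=h_1\cdots h_n$ for $n\ge1$. Let $(\Omega,\lambda)$ be a probability space and let $\tau$ be a randomized stopping time, i.e. a measurable function $\tau(\boldsymbol x,\omega)$ of a path $\boldsymbol x$ and of $\omega\in\Omega$, with values in $\{0,1,2,\dots\}\cup\{\infty\}$, such that for every $\omega\in\Omega$ the function $\tau(\cdot,\omega)$ is a stopping time for the filtration $\big(\sigma(x_0,\dots,x_n)\big)_{n\ge0}$. Assume that $\tau$ is bounded: there is a natural number $M$ with $\tau\le M$ $(\mathbf P\otimes\lambda)$-almost everywhere. Put $$\mu_\tau(g)=(\mathbf P\otimes\lambda)\{(\boldsymbol x,\omega): x_{\tau(\boldsymbol x,\omega)}=g\}\quad(g\in\Gamma),\qquad \mu_{\tau,t}=t\mu+(1-t)\mu_\tau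 .$$ For a probability measure $\theta$ on $\Gamma$, let $H^+(\Gamma,\theta)$ be the set of functions $f:\Gamma\to[0,\infty)$ such that, for every $g\in\Gamma$, the series $\sum_{h\in\Gamma}f(gh)\theta(h)$ converges absolutely and has sum $f(g)$. Then, for every $0<t\le1$, $$H^+(\Gamma,\mu)=H^+(\Gamma,\mu_{\tau,t}).$$ -/

import Mathlib

open MeasureTheory

/-- A measure `μ` on a discrete group is generating if its support
`{g | μ {g} ≠ 0}` generates the whole group as a semigroup. -/
def IsGenerating {Γ : Type*} [Group Γ] [MeasurableSpace Γ] (μ : Measure Γ) : Prop :=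
  Subsemigroup.closure {g : Γ | μ {g} ≠ 0} = ⊤

/-- The sample path `(e, h₁, h₁h₂, …)` with increments `h₁ = h 0`, `h₂ = h 1`, …. -/
def samplePath {Γ : Type*} [Group Γ] (h : ℕ → Γ) (n : ℕ) : Γ :=
  ((List.range n).map h).prod

/-- The law on path space of the random walk issued from the identity with i.i.d.
`μ`-distributed increments: the image of the product measure under `samplePath`. -/
noncomputable def walkLaw {Γ : Type*} [Group Γ] [MeasurableSpace Γ] (μ : Measure Γ) :
    Measure (ℕ → Γ) :=
  (Measure.infinitePi fun _ : ℕ => μ).map samplePath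

/-- A randomized stopping time over the auxiliary space `Ω`: a jointly measurable map such that,
for every `ω`, the map `x ↦ τ (x, ω)` is a stopping time for the filtration
`n ↦ σ(x₀, …, xₙ)` on path space. -/
structure IsRandomizedStoppingTime {Γ Ω : Type*} [MeasurableSpace Γ] [MeasurableSpace Ω]
    (τ : (ℕ → Γ) × Ω → ℕ∞) : Prop where
  measurable : Measurable τ
  isStoppingTime : ∀ ω : Ω,
    IsStoppingTime (Filtration.piLE (X := fun _ : ℕ => Γ)) fun x => τ (x, ω)

/-- `μ_τ(g)`: the probability that the walk, stopped at time `τ`, is at `g`. -/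
noncomputable def stoppedMass {Γ Ω : Type*} [Group Γ] [MeasurableSpace Γ] [MeasurableSpace Ω]
    (μ : Measure Γ) (lam : Measure Ω) (τ : (ℕ → Γ) × Ω → ℕ∞) (g : Γ) : ℝ :=
  ((walkLaw μ).prod lam).real {p | ∃ n : ℕ, τ p = n ∧ p.1 n = g}

/-- `f` is harmonic for the mass function `m`: at every `g`, the series `∑ₕ f(gh) m(h)`
converges absolutely, with sum `f g`. -/
def IsHarmonic {Γ : Type*} [Group Γ] (m : Γ → ℝ) (f : Γ → ℝ) : Prop :=
  ∀ g : Γ, (Summable fun h => |f (g * h) * m h|) ∧ ∑' h, f (g * h) * m h = f g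

/-- The positive (that is, nonnegative) harmonic functions `H⁺(Γ, m)`. -/
def positiveHarmonic {Γ : Type*} [Group Γ] (m : Γ → ℝ) : Set (Γ → ℝ) :=
  {f | (∀ g, 0 ≤ f g) ∧ IsHarmonic m f}

/-!
Write `P` for the one-step operator `stepOp μ`, acting on `[0, ∞]`-valued functions.

A `μ`-harmonic function is preserved by bounded stopping times, which gives one inclusion. For the
other, let `f` be harmonic for `t μ + (1 - t) μ_τ`. Then `f = t P f + (1 - t) E f(x_τ)`, where `μ_τ`
need not commute with `μ`, and all that is known is that one step of `μ` occurs with positive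
weight. The argument compares `f` with the upper and lower envelopes `U n` and `L n`: the largest
and the smallest means of `f` at a stopping time of the `μ`-walk bounded by `n`, given by
`U (n + 1) = max f (P (U n))` and `L (n + 1) = min f (P (L n))`, with `U 0 = L 0 = f`.

* Optional stopping (`lintegral_stopped_mem_Icc`): the mean of `f` at a stopping time with values in
  `[1, N + 1]` lies between `P (L N)` and `P (U N)`. Whether `τ` vanishes does not depend on the
  increments, so the atom of `τ` at zero can be divided out. Hence, after a change of weights,
  `t P f + s P (L N) ≤ f ≤ t P f + s P (U N)` with `t + s = 1` and `t > 0`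
  (`IsStoppingBalanced.of_stoppedMean`).
* These inequalities bound `U N` by a constant multiple of `L N`.
* Contraction (`IsStoppingBalanced.upperEnvelope_le_mul_lowerEnvelope`): if `U N ≤ (1 + δ) L N`,
  then `U N ≤ (1 + (1 - t ^ N) δ) L N`. This is a coupling argument. Expand `f` repeatedly by its
  own equation up to an optimal stopping time for `U N` or `L N`. With probability at least `t ^ N`,
  independently of the path, only single steps of `μ` are made, and then the expansion reaches the
  optimal time exactly, at no loss; otherwise it overshoots, and the loss is at most a factor
  `1 + δ`.

Letting `δ` tend to zero gives `L N = f = U N`, and therefore `P f = f` (for `N ≥ 1`).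

All sums are handled in `[0, ∞]`; this loses nothing for nonnegative functions
(`isHarmonic_iff_tsum_ofReal`). The generating hypothesis makes the group countable
(`IsGenerating.countable`), so that multiplication is measurable and `μ` is a sum of point masses.
-/

open scoped ENNReal NNReal

/-! ### The one-step operator and the stopping envelopes -/

section StepOperator

variable {Γ : Type*} [Group Γ] [MeasurableSpace Γ]

/-- The transition operator of the random walk with step law `μ`, acting on `[0, ∞]`-valued
functions: `stepOp μ u g` is the mean of `u` after one step from `g`. -/
noncomputable def stepOp (μ : Measure Γ) (u : Γ → ℝ≥0∞) (g : Γ) : ℝ≥0∞ :=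
  ∫⁻ h, u (g * h) ∂μ

/-- The value of the optimal stopping problem with reward `f` and horizon `n`: the supremum of
the means of `f` at a stopping time bounded by `n`, defined by backward recursion. -/
noncomputable def upperEnvelope (μ : Measure Γ) (f : Γ → ℝ≥0∞) : ℕ → Γ → ℝ≥0∞
  | 0 => f
  | n + 1 => fun g => max (f g) (stepOp μ (upperEnvelope μ f n) g)

/-- The value of the stopping problem with cost `f` and horizon `n`: the infimum of
the means of `f` at a stopping time bounded by `n`, defined by backward recursion. -/
noncomputable def lowerEnvelope (μ : Measure Γ) (f : Γ → ℝ≥0∞) : ℕ → Γ → ℝ≥0∞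
  | 0 => f
  | n + 1 => fun g => min (f g) (stepOp μ (lowerEnvelope μ f n) g)

variable {μ : Measure Γ} {f u v : Γ → ℝ≥0∞}

lemma upperEnvelope_succ (n : ℕ) (g : Γ) :
    upperEnvelope μ f (n + 1) g = max (f g) (stepOp μ (upperEnvelope μ f n) g) := rfl

lemma lowerEnvelope_succ (n : ℕ) (g : Γ) :
    lowerEnvelope μ f (n + 1) g = min (f g) (stepOp μ (lowerEnvelope μ f n) g) := rfl

lemma stepOp_mono (h : ∀ g, u g ≤ v g) (g : Γ) : stepOp μ u g ≤ stepOp μ v g :=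
  lintegral_mono fun _ => h _

lemma stepOp_const_mul [DiscreteMeasurableSpace Γ] (c : ℝ≥0∞) (u : Γ → ℝ≥0∞) (g : Γ) :
    stepOp μ (fun x => c * u x) g = c * stepOp μ u g :=
  lintegral_const_mul c .of_discrete

lemma stepOp_add [DiscreteMeasurableSpace Γ] (u v : Γ → ℝ≥0∞) (g : Γ) :
    stepOp μ (fun x => u x + v x) g = stepOp μ u g + stepOp μ v g :=
  lintegral_add_left .of_discrete _

lemma le_upperEnvelope (n : ℕ) (g : Γ) : f g ≤ upperEnvelope μ f n g := by
  cases n with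
  | zero => exact le_rfl
  | succ n => exact le_max_left _ _

lemma lowerEnvelope_le (n : ℕ) (g : Γ) : lowerEnvelope μ f n g ≤ f g := by
  cases n with
  | zero => exact le_rfl
  | succ n => exact min_le_left _ _

lemma upperEnvelope_mono (g : Γ) : Monotone fun n => upperEnvelope μ f n g := by
  suffices h : ∀ n g, upperEnvelope μ f n g ≤ upperEnvelope μ f (n + 1) g from
    monotone_nat_of_le_succ fun n => h n g
  intro n
  induction n with
  | zero => exact fun g => le_max_left _ _
  | succ n ih => exact fun g => max_le_max le_rfl (stepOp_mono ih g)

lemma lowerEnvelope_anti (g : Γ) : Antitone fun n => lowerEnvelope μ f n g := by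
  suffices h : ∀ n g, lowerEnvelope μ f (n + 1) g ≤ lowerEnvelope μ f n g from
    antitone_nat_of_succ_le fun n => h n g
  intro n
  induction n with
  | zero => exact fun g => min_le_left _ _
  | succ n ih => exact fun g => min_le_min le_rfl (stepOp_mono ih g)

lemma upperEnvelope_eq_of_stepOp_eq (h : ∀ g, stepOp μ f g = f g) (n : ℕ) :
    upperEnvelope μ f n = f := by
  induction n with
  | zero => rfl
  | succ n ih => funext g; simp [upperEnvelope, ih, h]

lemma lowerEnvelope_eq_of_stepOp_eq (h : ∀ g, stepOp μ f g = f g) (n : ℕ) :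
    lowerEnvelope μ f n = f := by
  induction n with
  | zero => rfl
  | succ n ih => funext g; simp [lowerEnvelope, ih, h]

/-! ### Contraction of the envelopes -/

/-- The two-sided bound satisfied by a function `f` that equals its mean at the randomized stopping
time which is a single step of `μ` with weight `t`, and a stopping time with values in `[1, N + 1]`
with weight `s`. This is all that is retained of the stopping time. -/
structure IsStoppingBalanced (μ : Measure Γ) (t s : ℝ≥0) (N : ℕ) (f : Γ → ℝ≥0∞) : Prop where
  lower : ∀ g, t * stepOp μ f g + s * stepOp μ (lowerEnvelope μ f N) g ≤ f g
  upper : ∀ g, f g ≤ t * stepOp μ f g + s * stepOp μ (upperEnvelope μ f N) g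

namespace IsStoppingBalanced

variable {t s : ℝ≥0} {N : ℕ}

lemma mul_stepOp_le (hf : IsStoppingBalanced μ t s N f) (g : Γ) : t * stepOp μ f g ≤ f g :=
  le_self_add.trans (hf.lower g)

section Discrete

variable [DiscreteMeasurableSpace Γ]

lemma pow_mul_upperEnvelope_le (hf : IsStoppingBalanced μ t s N f) (ht : t ≤ 1) (n : ℕ) (g : Γ) :
    (t : ℝ≥0∞) ^ n * upperEnvelope μ f n g ≤ f g := by
  have ht' : (t : ℝ≥0∞) ≤ 1 := by exact_mod_cast ht
  induction n generalizing g with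
  | zero => simp [upperEnvelope]
  | succ n ih =>
    rw [upperEnvelope_succ, mul_max]
    refine max_le (mul_le_of_le_one_left' (pow_le_one' ht' _)) ?_
    calc (t : ℝ≥0∞) ^ (n + 1) * stepOp μ (upperEnvelope μ f n) g
        = t * stepOp μ (fun x => (t : ℝ≥0∞) ^ n * upperEnvelope μ f n x) g := by
          rw [stepOp_const_mul]; ring
      _ ≤ t * stepOp μ f g := by gcongr; exact stepOp_mono ih g
      _ ≤ f g := hf.mul_stepOp_le g

lemma pow_mul_le_stepOp (hf : IsStoppingBalanced μ t s N f) (hts : t + s = 1) (g : Γ) :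
    (t : ℝ≥0∞) ^ N * f g ≤ stepOp μ f g := by
  have ht : t ≤ 1 := hts ▸ le_self_add
  have ht' : (t : ℝ≥0∞) ≤ 1 := by exact_mod_cast ht
  calc (t : ℝ≥0∞) ^ N * f g
      ≤ (t : ℝ≥0∞) ^ N * (t * stepOp μ f g + s * stepOp μ (upperEnvelope μ f N) g) := by
        gcongr; exact hf.upper g
    _ = (t : ℝ≥0∞) ^ N * (t * stepOp μ f g)
          + s * stepOp μ (fun x => (t : ℝ≥0∞) ^ N * upperEnvelope μ f N x) g := by
        rw [stepOp_const_mul]; ring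
    _ ≤ t * stepOp μ f g + s * stepOp μ f g := by
        refine add_le_add (mul_le_of_le_one_left' (pow_le_one' ht' _)) ?_
        gcongr
        exact stepOp_mono (hf.pow_mul_upperEnvelope_le ht N) g
    _ = stepOp μ f g := by
        rw [← add_mul]; norm_cast; rw [hts]; simp

lemma pow_mul_le_lowerEnvelope (hf : IsStoppingBalanced μ t s N f) (hts : t + s = 1) (n : ℕ)
    (g : Γ) : ((t : ℝ≥0∞) ^ N) ^ n * f g ≤ lowerEnvelope μ f n g := by
  have ht : t ≤ 1 := hts ▸ le_self_add
  have ht' : (t : ℝ≥0∞) ^ N ≤ 1 := pow_le_one' (by exact_mod_cast ht) _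
  induction n generalizing g with
  | zero => simp [lowerEnvelope]
  | succ n ih =>
    refine le_min (mul_le_of_le_one_left' (pow_le_one' ht' _)) ?_
    calc ((t : ℝ≥0∞) ^ N) ^ (n + 1) * f g = ((t : ℝ≥0∞) ^ N) ^ n * ((t : ℝ≥0∞) ^ N * f g) := by
          ring
      _ ≤ ((t : ℝ≥0∞) ^ N) ^ n * stepOp μ f g := by
          gcongr; exact hf.pow_mul_le_stepOp hts g
      _ = stepOp μ (fun x => ((t : ℝ≥0∞) ^ N) ^ n * f x) g := (stepOp_const_mul _ _ _).symm
      _ ≤ _ := stepOp_mono ih g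

/-- Expanding `f` up to an optimal time for the lower envelope takes only single steps of `μ` with
probability at least `t ^ j`, and then meets the optimal time exactly; this gains
`t ^ j * δ` over the trivial bound `1 + δ`. -/
lemma add_le_mul_lowerEnvelope (hf : IsStoppingBalanced μ t s N f) (hts : t + s = 1) {δ : ℝ≥0}
    (hδ : ∀ g, upperEnvelope μ f N g ≤ (1 + δ) * lowerEnvelope μ f N g) {j : ℕ} (hj : j ≤ N)
    (g : Γ) : f g + t ^ j * δ * lowerEnvelope μ f j g ≤ (1 + δ) * lowerEnvelope μ f j g := by
  have ht' : (t : ℝ≥0∞) ≤ 1 := by exact_mod_cast (hts ▸ le_self_add : t ≤ 1)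
  induction j generalizing g with
  | zero => simp [lowerEnvelope, add_mul]
  | succ j ih =>
    rcases min_choice (f g) (stepOp μ (lowerEnvelope μ f j) g) with h | h
    · rw [lowerEnvelope_succ, h, add_mul, one_mul]
      gcongr
      exact mul_le_of_le_one_left' (pow_le_one' ht' _)
    · rw [lowerEnvelope_succ, h]
      have h1 : stepOp μ f g + t ^ j * δ * stepOp μ (lowerEnvelope μ f j) g
          ≤ (1 + δ) * stepOp μ (lowerEnvelope μ f j) g := by
        rw [← stepOp_const_mul, ← stepOp_const_mul, ← stepOp_add]
        exact stepOp_mono (ih (by omega)) g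
      have h2 : stepOp μ (upperEnvelope μ f N) g
          ≤ (1 + δ) * stepOp μ (lowerEnvelope μ f j) g := by
        rw [← stepOp_const_mul]
        refine stepOp_mono (fun x => (hδ x).trans ?_) g
        gcongr
        exact lowerEnvelope_anti x (by omega : j ≤ N)
      calc f g + t ^ (j + 1) * δ * stepOp μ (lowerEnvelope μ f j) g
          ≤ t * stepOp μ f g + s * stepOp μ (upperEnvelope μ f N) g
            + t ^ (j + 1) * δ * stepOp μ (lowerEnvelope μ f j) g := by
            gcongr; exact hf.upper g
        _ = t * (stepOp μ f g + t ^ j * δ * stepOp μ (lowerEnvelope μ f j) g)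
            + s * stepOp μ (upperEnvelope μ f N) g := by ring
        _ ≤ t * ((1 + δ) * stepOp μ (lowerEnvelope μ f j) g)
            + s * ((1 + δ) * stepOp μ (lowerEnvelope μ f j) g) := by gcongr
        _ = (1 + δ) * stepOp μ (lowerEnvelope μ f j) g := by
            rw [← add_mul]; norm_cast; rw [hts]; simp

/-- The counterpart of `add_le_mul_lowerEnvelope` for the upper envelope. -/
lemma add_upperEnvelope_le_mul (hf : IsStoppingBalanced μ t s N f) (hts : t + s = 1) {δ : ℝ≥0}
    (hδ : ∀ g, upperEnvelope μ f N g ≤ (1 + δ) * lowerEnvelope μ f N g) {j : ℕ} (hj : j ≤ N)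
    (g : Γ) : upperEnvelope μ f j g + t ^ j * δ * upperEnvelope μ f j g ≤ (1 + δ) * f g := by
  have ht' : (t : ℝ≥0∞) ≤ 1 := by exact_mod_cast (hts ▸ le_self_add : t ≤ 1)
  induction j generalizing g with
  | zero => simp [upperEnvelope, add_mul]
  | succ j ih =>
    rcases max_choice (f g) (stepOp μ (upperEnvelope μ f j) g) with h | h
    · rw [upperEnvelope_succ, h, add_mul, one_mul]
      gcongr
      exact mul_le_of_le_one_left' (pow_le_one' ht' _)
    · rw [upperEnvelope_succ, h]
      have h1 : stepOp μ (upperEnvelope μ f j) g + t ^ j * δ * stepOp μ (upperEnvelope μ f j) g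
          ≤ (1 + δ) * stepOp μ f g := by
        rw [← stepOp_const_mul, ← stepOp_const_mul, ← stepOp_add]
        exact stepOp_mono (ih (by omega)) g
      have h2 : stepOp μ (upperEnvelope μ f j) g
          ≤ (1 + δ) * stepOp μ (lowerEnvelope μ f N) g := by
        rw [← stepOp_const_mul]
        exact stepOp_mono (fun x => (upperEnvelope_mono x (by omega : j ≤ N)).trans (hδ x)) g
      calc stepOp μ (upperEnvelope μ f j) g + t ^ (j + 1) * δ * stepOp μ (upperEnvelope μ f j) g
          = ((t + s : ℝ≥0) : ℝ≥0∞) * stepOp μ (upperEnvelope μ f j) g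
            + t ^ (j + 1) * δ * stepOp μ (upperEnvelope μ f j) g := by rw [hts]; simp
        _ = t * (stepOp μ (upperEnvelope μ f j) g
              + t ^ j * δ * stepOp μ (upperEnvelope μ f j) g)
            + s * stepOp μ (upperEnvelope μ f j) g := by push_cast; ring
        _ ≤ t * ((1 + δ) * stepOp μ f g)
            + s * ((1 + δ) * stepOp μ (lowerEnvelope μ f N) g) := by gcongr
        _ = (1 + δ) * (t * stepOp μ f g + s * stepOp μ (lowerEnvelope μ f N) g) := by ring
        _ ≤ (1 + δ) * f g := by gcongr; exact hf.lower g

/-- The relative gap between the envelopes contracts by the factor `1 - t ^ N`. -/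
lemma upperEnvelope_le_mul_lowerEnvelope (hf : IsStoppingBalanced μ t s N f) (hts : t + s = 1)
    (hfin : ∀ g, f g ≠ ∞) {δ δ' : ℝ≥0} (hδδ' : δ' + t ^ N * δ = δ)
    (hδ : ∀ g, upperEnvelope μ f N g ≤ (1 + δ) * lowerEnvelope μ f N g) (g : Γ) :
    upperEnvelope μ f N g ≤ (1 + δ') * lowerEnvelope μ f N g := by
  have ht : t ≤ 1 := hts ▸ le_self_add
  have hsum : (δ : ℝ≥0∞) = δ' + t ^ N * δ := by exact_mod_cast hδδ'.symm
  have hpow {j : ℕ} (hj : j ≤ N) : (t : ℝ≥0∞) ^ N ≤ t ^ j := by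
    exact_mod_cast pow_le_pow_right_of_le_one' ht hj
  have hlow {j : ℕ} (hj : j ≤ N) (g : Γ) : f g ≤ (1 + δ') * lowerEnvelope μ f j g := by
    have hne : (t : ℝ≥0∞) ^ N * δ * lowerEnvelope μ f j g ≠ ∞ :=
      ENNReal.mul_ne_top (by finiteness) (ne_top_of_le_ne_top (hfin g) (lowerEnvelope_le j g))
    refine (ENNReal.add_le_add_iff_right hne).1 ?_
    calc f g + t ^ N * δ * lowerEnvelope μ f j g
        ≤ f g + t ^ j * δ * lowerEnvelope μ f j g := by gcongr _ + ?_ * _ * _; exact hpow hj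
      _ ≤ (1 + δ) * lowerEnvelope μ f j g := hf.add_le_mul_lowerEnvelope hts hδ hj g
      _ = (1 + δ') * lowerEnvelope μ f j g + t ^ N * δ * lowerEnvelope μ f j g := by
        nth_rw 1 [hsum]; ring
  have hupp {j : ℕ} (hj : j ≤ N) (g : Γ) : upperEnvelope μ f j g ≤ (1 + δ') * f g := by
    have hne : (1 + (t : ℝ≥0∞) ^ N * δ) ≠ ∞ := by finiteness
    refine (ENNReal.mul_le_mul_iff_right (a := 1 + (t : ℝ≥0∞) ^ N * δ) (by simp) hne).1 ?_
    calc (1 + (t : ℝ≥0∞) ^ N * δ) * upperEnvelope μ f j g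
        = upperEnvelope μ f j g + t ^ N * δ * upperEnvelope μ f j g := by ring
      _ ≤ upperEnvelope μ f j g + t ^ j * δ * upperEnvelope μ f j g := by
        gcongr _ + ?_ * _ * _; exact hpow hj
      _ ≤ (1 + δ) * f g := hf.add_upperEnvelope_le_mul hts hδ hj g
      _ ≤ ((1 + t ^ N * δ) * (1 + δ')) * f g := by
        gcongr
        nth_rw 1 [hsum]
        calc 1 + (δ' + (t : ℝ≥0∞) ^ N * δ) ≤ 1 + (δ' + (t : ℝ≥0∞) ^ N * δ) + t ^ N * δ * δ' :=
              le_self_add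
          _ = _ := by ring
      _ = _ := by ring
  have key : ∀ j ≤ N, ∀ g, upperEnvelope μ f j g ≤ (1 + δ') * lowerEnvelope μ f j g := by
    intro j
    induction j with
    | zero => exact fun hj g => hlow hj g
    | succ j ih =>
      intro hj g
      refine max_le (hlow hj g) ?_
      rw [lowerEnvelope_succ, mul_min]
      refine le_min ((le_max_right _ _).trans (hupp hj g)) ?_
      rw [← stepOp_const_mul]
      exact stepOp_mono (ih (by omega)) g
  exact key N le_rfl g

lemma upperEnvelope_le_lowerEnvelope (hf : IsStoppingBalanced μ t s N f) (hts : t + s = 1)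
    (ht : 0 < t) (hfin : ∀ g, f g ≠ ∞) (g : Γ) :
    upperEnvelope μ f N g ≤ lowerEnvelope μ f N g := by
  have ht1 : t ≤ 1 := hts ▸ le_self_add
  have hε : t ^ N ≤ 1 := pow_le_one' ht1 _
  set ε := t ^ N with hεdef
  have hε0 : 0 < ε := pow_pos ht _
  have hcast : (ε : ℝ≥0∞) = (t : ℝ≥0∞) ^ N := by rw [hεdef]; push_cast; rfl
  -- an initial bound for the gap, from the comparability of `f` and `stepOp μ f`
  obtain ⟨δ, hδ⟩ : ∃ δ : ℝ≥0, ∀ g, upperEnvelope μ f N g ≤ (1 + δ) * lowerEnvelope μ f N g := by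
    refine ⟨(ε ^ N * ε)⁻¹, fun g => ?_⟩
    have hc : ε ^ N * ε ≠ 0 := by positivity
    have h : ((ε ^ N * ε : ℝ≥0) : ℝ≥0∞) * upperEnvelope μ f N g ≤ lowerEnvelope μ f N g :=
      calc ((ε ^ N * ε : ℝ≥0) : ℝ≥0∞) * upperEnvelope μ f N g
          = (ε : ℝ≥0∞) ^ N * (ε * upperEnvelope μ f N g) := by push_cast; ring
        _ ≤ (ε : ℝ≥0∞) ^ N * f g := by
          gcongr; rw [hcast]; exact hf.pow_mul_upperEnvelope_le ht1 N g
        _ ≤ _ := by rw [hcast]; exact hf.pow_mul_le_lowerEnvelope hts N g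
    rw [ENNReal.coe_inv hc]
    calc upperEnvelope μ f N g
        = ((ε ^ N * ε : ℝ≥0) : ℝ≥0∞)⁻¹ * (((ε ^ N * ε : ℝ≥0) : ℝ≥0∞) * upperEnvelope μ f N g) := by
          rw [← mul_assoc, ENNReal.inv_mul_cancel (by exact_mod_cast hc) ENNReal.coe_ne_top,
            one_mul]
      _ ≤ _ := by gcongr; exact le_add_self
  have hiter (n : ℕ) : ∀ g, upperEnvelope μ f N g
      ≤ (1 + ((1 - ε) ^ n * δ : ℝ≥0)) * lowerEnvelope μ f N g := by
    induction n with
    | zero => simpa using hδ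
    | succ n ih =>
      refine hf.upperEnvelope_le_mul_lowerEnvelope hts hfin ?_ ih
      calc (1 - ε) ^ (n + 1) * δ + ε * ((1 - ε) ^ n * δ)
          = ((1 - ε) + ε) * ((1 - ε) ^ n * δ) := by ring
        _ = _ := by rw [tsub_add_cancel_of_le hε, one_mul]
  have hlim : Filter.Tendsto (fun n : ℕ =>
      (1 + (((1 - ε) ^ n * δ : ℝ≥0) : ℝ≥0∞)) * lowerEnvelope μ f N g) Filter.atTop
      (nhds ((1 + ((0 * δ : ℝ≥0) : ℝ≥0∞)) * lowerEnvelope μ f N g)) := by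
    refine ENNReal.Tendsto.mul_const (Filter.Tendsto.const_add _ ?_) (Or.inl (by simp))
    refine ENNReal.tendsto_coe.2 (Filter.Tendsto.mul_const _ ?_)
    exact NNReal.tendsto_pow_atTop_nhds_zero_of_lt_one (tsub_lt_self one_pos hε0)
  simpa using ge_of_tendsto' hlim fun n => hiter n g

theorem stepOp_eq (hf : IsStoppingBalanced μ t s N f) (hts : t + s = 1)
    (ht : 0 < t) (hN : 1 ≤ N) (hfin : ∀ g, f g ≠ ∞) (g : Γ) : stepOp μ f g = f g := by
  have h := hf.upperEnvelope_le_lowerEnvelope hts ht hfin g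
  refine le_antisymm ?_ ?_
  · calc stepOp μ f g ≤ upperEnvelope μ f 1 g := le_max_right _ _
      _ ≤ upperEnvelope μ f N g := upperEnvelope_mono g hN
      _ ≤ lowerEnvelope μ f N g := h
      _ ≤ f g := lowerEnvelope_le N g
  · calc f g ≤ upperEnvelope μ f N g := le_upperEnvelope N g
      _ ≤ lowerEnvelope μ f N g := h
      _ ≤ lowerEnvelope μ f 1 g := lowerEnvelope_anti g hN
      _ ≤ stepOp μ f g := min_le_right _ _

end Discrete

end IsStoppingBalanced

end StepOperator

/-! ### Markov property and optional stopping -/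

lemma measurableSet_lt_stoppingTime {Γ : Type*} [MeasurableSpace Γ] {σ : (ℕ → Γ) → ℕ∞}
    (hσ : IsStoppingTime (Filtration.piLE (X := fun _ : ℕ => Γ)) σ) (n : ℕ) :
    MeasurableSet[Filtration.piLE (X := fun _ : ℕ => Γ) n] {x | (n : ℕ∞) < σ x} :=
  hσ.measurableSet_gt n

section OptionalStopping

variable {Γ : Type*} [Group Γ] {h : ℕ → Γ}

lemma samplePath_zero : samplePath h 0 = 1 := by simp [samplePath]

lemma samplePath_succ (n : ℕ) : samplePath h (n + 1) = samplePath h n * h n := by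
  simp [samplePath, List.range_succ]

lemma samplePath_congr {h h' : ℕ → Γ} {n : ℕ} (H : ∀ k < n, h k = h' k) :
    samplePath h n = samplePath h' n := by
  unfold samplePath
  congr 1
  exact List.map_congr_left fun k hk => H k (List.mem_range.1 hk)

variable [MeasurableSpace Γ] {μ : Measure Γ}

lemma stepOp_translate (u : Γ → ℝ≥0∞) (g x : Γ) :
    stepOp μ (fun y => u (g * y)) x = stepOp μ u (g * x) := by
  simp [stepOp, mul_assoc]

variable {σ : (ℕ → Γ) → ℕ∞}

/-- On `{n < σ ≤ n + 1}` the walk stops at time `n + 1`; otherwise it goes on. -/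
lemma setLIntegral_stopped_split
    (hσ : IsStoppingTime (Filtration.piLE (X := fun _ : ℕ => Γ)) σ) (v : (ℕ → Γ) → ℝ≥0∞) (n : ℕ) :
    ∫⁻ x in {x | (n : ℕ∞) < σ x}, v x ∂walkLaw μ
      = ∫⁻ x in {x | (n : ℕ∞) < σ x} ∩ {x | σ x ≤ (n + 1 : ℕ)}, v x ∂walkLaw μ
        + ∫⁻ x in {x | ((n + 1 : ℕ) : ℕ∞) < σ x}, v x ∂walkLaw μ := by
  have hm : MeasurableSet {x | σ x ≤ (n + 1 : ℕ)} := Filtration.piLE.le (n + 1) _ (hσ (n + 1))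
  have hdiff : {x | (n : ℕ∞) < σ x} \ {x | σ x ≤ (n + 1 : ℕ)}
      = {x | ((n + 1 : ℕ) : ℕ∞) < σ x} := by
    ext x
    change ((n : ℕ∞) < σ x ∧ ¬ σ x ≤ (n + 1 : ℕ)) ↔ ((n + 1 : ℕ) : ℕ∞) < σ x
    rw [not_le]
    refine ⟨fun hx => hx.2, fun hx => ⟨lt_trans ?_ hx, hx⟩⟩
    exact_mod_cast n.lt_succ_self
  rw [← lintegral_inter_add_sdiff v {x | (n : ℕ∞) < σ x} hm, hdiff]

/-- On `{n < σ ≤ n + 1}` the stopped walk is at its position at time `n + 1`. -/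
lemma setLIntegral_stopped_eq
    (hσ : IsStoppingTime (Filtration.piLE (X := fun _ : ℕ => Γ)) σ) (v : Γ → ℝ≥0∞) (n : ℕ) :
    ∫⁻ x in {x | (n : ℕ∞) < σ x} ∩ {x | σ x ≤ (n + 1 : ℕ)}, v (x (σ x).toNat) ∂walkLaw μ
      = ∫⁻ x in {x | (n : ℕ∞) < σ x} ∩ {x | σ x ≤ (n + 1 : ℕ)}, v (x (n + 1)) ∂walkLaw μ := by
  refine setLIntegral_congr_fun ((Filtration.piLE.le n _ (hσ.measurableSet_gt n)).inter
    (Filtration.piLE.le (n + 1) _ (hσ (n + 1)))) fun x hx => ?_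
  have h1 : σ x = (n + 1 : ℕ) := le_antisymm hx.2 (by
    have : (n : ℕ∞) < σ x := hx.1
    rw [Nat.cast_add_one]
    exact Order.add_one_le_of_lt this)
  simp only [h1, ENat.toNat_natCast]

lemma setLIntegral_eq_zero_of_ae_le {n : ℕ} (hb : ∀ᵐ x ∂walkLaw μ, σ x ≤ n)
    (v : (ℕ → Γ) → ℝ≥0∞) : ∫⁻ x in {x | (n : ℕ∞) < σ x}, v x ∂walkLaw μ = 0 := by
  refine setLIntegral_measure_zero _ _ ?_
  simpa [ae_iff] using hb

/-- Whether a stopping time vanishes is decided by the starting point of the path. -/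
lemma isStoppingTime_eq_zero_iff
    (hσ : IsStoppingTime (Filtration.piLE (X := fun _ : ℕ => Γ)) σ) {x : ℕ → Γ} (hx : x 0 = 1) :
    σ x = 0 ↔ σ (fun _ => 1) = 0 := by
  obtain ⟨B, -, hB⟩ := hσ 0
  have hmem (y : ℕ → Γ) : σ y = 0 ↔ Preorder.restrictLe 0 y ∈ B := by
    have : y ∈ Preorder.restrictLe 0 ⁻¹' B ↔ σ y ≤ ((0 : ℕ) : ℕ∞) := by rw [hB]; rfl
    rw [← Set.mem_preimage, this]
    simp
  rw [hmem, hmem]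
  have : Preorder.restrictLe 0 x = Preorder.restrictLe (π := fun _ : ℕ => Γ) 0 fun _ => 1 := by
    funext ⟨i, hi⟩
    obtain rfl : i = 0 := by simpa using hi
    exact hx
  rw [this]

variable [DiscreteMeasurableSpace Γ] [Countable Γ]

lemma measurable_samplePath : Measurable (samplePath : (ℕ → Γ) → ℕ → Γ) := by
  refine measurable_pi_lambda _ fun n => ?_
  induction n with
  | zero => simp only [samplePath_zero]; exact measurable_const
  | succ n ih =>
    simp only [samplePath_succ]
    exact (measurable_of_countable fun p : Γ × Γ => p.1 * p.2).comp
      (ih.prodMk (measurable_pi_apply n))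

lemma walkLaw_ae_zero : ∀ᵐ x ∂walkLaw μ, x 0 = 1 := by
  refine (ae_map_iff measurable_samplePath.aemeasurable ?_).2 (.of_forall fun h => samplePath_zero)
  exact measurableSet_eq_fun (measurable_pi_apply 0) measurable_const

variable [IsProbabilityMeasure μ]

instance isProbabilityMeasure_walkLaw : IsProbabilityMeasure (walkLaw μ) :=
  Measure.isProbabilityMeasure_map measurable_samplePath.aemeasurable

/-- The next increment is independent of the path up to the present. -/
lemma indepFun_samplePath_increment (n : ℕ) :
    ProbabilityTheory.IndepFun (fun h : ℕ → Γ => Preorder.restrictLe n (samplePath h))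
      (fun h : ℕ → Γ => h n) (Measure.infinitePi fun _ : ℕ => μ) := by
  classical
  have hind := (ProbabilityTheory.iIndepFun_infinitePi (P := fun _ : ℕ => μ)
    (X := fun _ g => g) fun _ => measurable_id).indepFun_finset (Finset.range n) {n} (by simp)
    fun i => measurable_pi_apply i
  let φ : (Finset.range n → Γ) → Set.Iic n → Γ := fun r =>
    Preorder.restrictLe n (samplePath fun k => if hk : k ∈ Finset.range n then r ⟨k, hk⟩ else 1)
  have hφ : Measurable φ := by
    refine (Preorder.measurable_restrictLe n).comp (measurable_samplePath.comp ?_)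
    refine measurable_pi_lambda _ fun k => ?_
    by_cases hk : k ∈ Finset.range n
    · simpa [hk] using measurable_pi_apply _
    · simp [hk]
  let ψ : (({n} : Finset ℕ) → Γ) → Γ := fun r => r ⟨n, by simp⟩
  have hψ : Measurable ψ := measurable_pi_apply _
  have hcomp := hind.comp hφ hψ
  have hX : (fun h : ℕ → Γ => Preorder.restrictLe n (samplePath h))
      = φ ∘ fun (h : ℕ → Γ) (i : Finset.range n) => h i := by
    funext h i
    refine samplePath_congr fun k hk => ?_
    have : k < n := hk.trans_le i.2
    simp [this]
  rw [hX]
  exact hcomp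

/-- The Markov property. -/
lemma setLIntegral_walkLaw_succ (u : Γ → ℝ≥0∞) {n : ℕ} {A : Set (ℕ → Γ)}
    (hA : MeasurableSet[Filtration.piLE (X := fun _ : ℕ => Γ) n] A) :
    ∫⁻ x in A, u (x (n + 1)) ∂walkLaw μ = ∫⁻ x in A, stepOp μ u (x n) ∂walkLaw μ := by
  have hA' : MeasurableSet A := Filtration.piLE.le n A hA
  obtain ⟨B, hB, rfl⟩ := hA
  set ν := Measure.infinitePi fun _ : ℕ => μ with hν
  set X : (ℕ → Γ) → Set.Iic n → Γ := fun h => Preorder.restrictLe n (samplePath h) with hX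
  have hXm : Measurable X := (Preorder.measurable_restrictLe n).comp measurable_samplePath
  have hjoint : ν.map (fun h => (X h, h n)) = (ν.map X).prod μ := by
    rw [(ProbabilityTheory.indepFun_iff_map_prod_eq_prod_map_map hXm.aemeasurable
      (measurable_pi_apply n).aemeasurable).1 (indepFun_samplePath_increment n)]
    congr 1
    exact Measure.infinitePi_map_eval (fun _ : ℕ => μ) n
  let last : Set.Iic n := ⟨n, Set.mem_Iic.2 le_rfl⟩
  let F : (Set.Iic n → Γ) × Γ → ℝ≥0∞ := fun p =>
    B.indicator (fun _ => 1) p.1 * u (p.1 last * p.2)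
  have hF : Measurable F := by
    refine ((measurable_const.indicator hB).comp measurable_fst).mul ?_
    have hlast : Measurable fun p : (Set.Iic n → Γ) × Γ => p.1 last :=
      (measurable_pi_apply last).comp measurable_fst
    exact (measurable_of_countable fun q : Γ × Γ => u (q.1 * q.2)).comp
      (hlast.prodMk measurable_snd)
  have hind (v : (ℕ → Γ) → ℝ≥0∞) (hv : Measurable v) :
      ∫⁻ x in Preorder.restrictLe n ⁻¹' B, v x ∂walkLaw μ
        = ∫⁻ h, B.indicator (fun _ => 1) (X h) * v (samplePath h) ∂ν := by
    rw [← lintegral_indicator hA', walkLaw, lintegral_map (hv.indicator hA') measurable_samplePath]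
    refine lintegral_congr fun h => ?_
    by_cases hh : X h ∈ B
    · rw [Set.indicator_of_mem hh, one_mul, Set.indicator_of_mem (by exact hh)]
    · rw [Set.indicator_of_notMem hh, zero_mul, Set.indicator_of_notMem (by exact hh)]
  have hcoord (v : Γ → ℝ≥0∞) (k : ℕ) : Measurable fun x : ℕ → Γ => v (x k) :=
    (Measurable.of_discrete (f := v)).comp (measurable_pi_apply k)
  rw [hind _ (hcoord u (n + 1)), hind _ (hcoord (stepOp μ u) n)]
  calc ∫⁻ h, B.indicator (fun _ => 1) (X h) * u (samplePath h (n + 1)) ∂ν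
      = ∫⁻ h, F (X h, h n) ∂ν := by
        refine lintegral_congr fun h => ?_
        simp only [F, samplePath_succ]
        rfl
    _ = ∫⁻ y, ∫⁻ k, F (y, k) ∂μ ∂(ν.map X) := by
        rw [← lintegral_map hF (hXm.prodMk (measurable_pi_apply n)), hjoint,
          lintegral_prod _ hF.aemeasurable]
    _ = ∫⁻ y, B.indicator (fun _ => 1) y * stepOp μ u (y last) ∂(ν.map X) :=
        lintegral_congr fun y => lintegral_const_mul (μ := μ) (B.indicator (fun _ => 1) y)
          (f := fun k => u (y last * k)) .of_discrete
    _ = ∫⁻ h, B.indicator (fun _ => 1) (X h) * stepOp μ u (samplePath h n) ∂ν := by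
        refine lintegral_map ?_ hXm
        exact (measurable_const.indicator hB).mul
          ((Measurable.of_discrete (f := stepOp μ u)).comp (measurable_pi_apply last))

lemma setLIntegral_stopped_le_upperEnvelope
    (hσ : IsStoppingTime (Filtration.piLE (X := fun _ : ℕ => Γ)) σ) (f : Γ → ℝ≥0∞) (g : Γ)
    (k n : ℕ) (hb : ∀ᵐ x ∂walkLaw μ, σ x ≤ (n + 1 + k : ℕ)) :
    ∫⁻ x in {x | (n : ℕ∞) < σ x}, f (g * x (σ x).toNat) ∂walkLaw μ
      ≤ ∫⁻ x in {x | (n : ℕ∞) < σ x}, stepOp μ (upperEnvelope μ f k) (g * x n) ∂walkLaw μ := by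
  have hmarkov := setLIntegral_walkLaw_succ (μ := μ) (fun y => upperEnvelope μ f k (g * y))
    (measurableSet_lt_stoppingTime hσ n)
  simp only [stepOp_translate] at hmarkov
  refine le_trans ?_ hmarkov.le
  rw [setLIntegral_stopped_split hσ _ n, setLIntegral_stopped_split hσ _ n,
    setLIntegral_stopped_eq hσ (fun y => f (g * y)) n]
  refine add_le_add (lintegral_mono fun x => le_upperEnvelope _ _) ?_
  cases k with
  | zero => rw [setLIntegral_eq_zero_of_ae_le hb]; exact zero_le
  | succ k =>
    refine (setLIntegral_stopped_le_upperEnvelope hσ f g k (n + 1) ?_).trans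
      (lintegral_mono fun x => le_max_right _ _)
    convert hb using 4
    omega

lemma lowerEnvelope_le_setLIntegral_stopped
    (hσ : IsStoppingTime (Filtration.piLE (X := fun _ : ℕ => Γ)) σ) (f : Γ → ℝ≥0∞) (g : Γ)
    (k n : ℕ) (hb : ∀ᵐ x ∂walkLaw μ, σ x ≤ (n + 1 + k : ℕ)) :
    ∫⁻ x in {x | (n : ℕ∞) < σ x}, stepOp μ (lowerEnvelope μ f k) (g * x n) ∂walkLaw μ
      ≤ ∫⁻ x in {x | (n : ℕ∞) < σ x}, f (g * x (σ x).toNat) ∂walkLaw μ := by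
  have hmarkov := setLIntegral_walkLaw_succ (μ := μ) (fun y => lowerEnvelope μ f k (g * y))
    (measurableSet_lt_stoppingTime hσ n)
  simp only [stepOp_translate] at hmarkov
  refine le_trans hmarkov.ge ?_
  rw [setLIntegral_stopped_split hσ _ n, setLIntegral_stopped_split hσ _ n,
    setLIntegral_stopped_eq hσ (fun y => f (g * y)) n]
  refine add_le_add (lintegral_mono fun x => lowerEnvelope_le _ _) ?_
  cases k with
  | zero => rw [setLIntegral_eq_zero_of_ae_le hb]; exact zero_le
  | succ k =>
    refine (lintegral_mono fun x => min_le_right _ _).trans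
      (lowerEnvelope_le_setLIntegral_stopped hσ f g k (n + 1) ?_)
    convert hb using 4
    omega

lemma lintegral_stopped_of_eq_zero
    (hσ : IsStoppingTime (Filtration.piLE (X := fun _ : ℕ => Γ)) σ) (h0 : σ (fun _ => 1) = 0)
    (f : Γ → ℝ≥0∞) (g : Γ) : ∫⁻ x, f (g * x (σ x).toNat) ∂walkLaw μ = f g := by
  have : ∀ᵐ x ∂walkLaw μ, f (g * x (σ x).toNat) = f g := by
    filter_upwards [walkLaw_ae_zero] with x hx
    simp [(isStoppingTime_eq_zero_iff hσ hx).2 h0, hx]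
  rw [lintegral_congr_ae this]
  simp

/-- Optional stopping: the mean of `f` at a stopping time with values in `[1, k + 1]` lies between
the one-step means of the envelopes with horizon `k`. -/
lemma lintegral_stopped_mem_Icc
    (hσ : IsStoppingTime (Filtration.piLE (X := fun _ : ℕ => Γ)) σ) (h0 : σ (fun _ => 1) ≠ 0)
    (f : Γ → ℝ≥0∞) (g : Γ) {k : ℕ} (hb : ∀ᵐ x ∂walkLaw μ, σ x ≤ (k + 1 : ℕ)) :
    ∫⁻ x, f (g * x (σ x).toNat) ∂walkLaw μ ∈
      Set.Icc (stepOp μ (lowerEnvelope μ f k) g) (stepOp μ (upperEnvelope μ f k) g) := by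
  have hb' : ∀ᵐ x ∂walkLaw μ, σ x ≤ (0 + 1 + k : ℕ) := by convert hb using 4; omega
  have hpos : ∀ᵐ x ∂walkLaw μ, x ∈ {x | ((0 : ℕ) : ℕ∞) < σ x} := by
    filter_upwards [walkLaw_ae_zero] with x hx
    have := (isStoppingTime_eq_zero_iff hσ hx).not.2 h0
    simpa [pos_iff_ne_zero] using this
  have hstart (v : Γ → ℝ≥0∞) : ∫⁻ x, v (g * x 0) ∂walkLaw μ = v g := by
    have : ∀ᵐ x ∂walkLaw μ, v (g * x 0) = v g := by
      filter_upwards [walkLaw_ae_zero] with x hx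
      simp [hx]
    rw [lintegral_congr_ae this]
    simp
  have hu := setLIntegral_stopped_le_upperEnvelope hσ f g k 0 hb'
  have hl := lowerEnvelope_le_setLIntegral_stopped hσ f g k 0 hb'
  rw [Measure.restrict_eq_self_of_ae_mem hpos, hstart] at hu hl
  exact ⟨hl, hu⟩

end OptionalStopping

/-! ### Harmonicity in `[0, ∞]` and countability of the group -/

lemma isHarmonic_iff_tsum_ofReal {Γ : Type*} [Group Γ] {m f : Γ → ℝ} (hm : ∀ g, 0 ≤ m g)
    (hf : ∀ g, 0 ≤ f g) :
    IsHarmonic m f ↔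
      ∀ g, ∑' h, ENNReal.ofReal (f (g * h)) * ENNReal.ofReal (m h) = ENNReal.ofReal (f g) := by
  have hnn (g h : Γ) : 0 ≤ f (g * h) * m h := mul_nonneg (hf _) (hm _)
  refine forall_congr' fun g => ?_
  simp only [← ENNReal.ofReal_mul (hf _), abs_of_nonneg (hnn _ _)]
  constructor
  · rintro ⟨hs, h⟩
    rw [← ENNReal.ofReal_tsum_of_nonneg (hnn g) hs, h]
  · intro h
    have hs : Summable fun h => f (g * h) * m h := by
      have := ENNReal.summable_toReal (h ▸ ENNReal.ofReal_ne_top :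
        ∑' h, ENNReal.ofReal (f (g * h) * m h) ≠ ∞)
      simpa only [ENNReal.toReal_ofReal (hnn g _)] using this
    refine ⟨hs, ?_⟩
    rw [← ENNReal.ofReal_tsum_of_nonneg (hnn g) hs] at h
    exact (ENNReal.ofReal_eq_ofReal_iff (tsum_nonneg (hnn g)) (hf g)).1 h

lemma IsGenerating.countable {Γ : Type*} [Group Γ] [MeasurableSpace Γ]
    [DiscreteMeasurableSpace Γ] {μ : Measure Γ} [IsProbabilityMeasure μ] (hμ : IsGenerating μ) :
    Countable Γ := by
  have hS : {g : Γ | μ {g} ≠ 0}.Countable := by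
    have := Measure.countable_meas_pos_of_disjoint_iUnion (μ := μ) (As := fun g : Γ => {g})
      (fun g => .of_discrete) (fun a b hab => by simpa [Function.onFun] using hab)
    simpa [pos_iff_ne_zero] using this
  have : Countable {g : Γ | μ {g} ≠ 0} := hS.to_subtype
  have hsurj : Function.Surjective fun l : List {g : Γ | μ {g} ≠ 0} =>
      (l.map Subtype.val).prod := by
    intro g
    have hg : g ∈ Subsemigroup.closure {g : Γ | μ {g} ≠ 0} := by rw [hμ]; trivial
    induction hg using Subsemigroup.closure_induction with
    | mem x hx => exact ⟨[⟨x, hx⟩], by simp⟩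
    | mul x y _ _ hx hy =>
      obtain ⟨l, rfl⟩ := hx
      obtain ⟨l', rfl⟩ := hy
      exact ⟨l ++ l', by simp⟩
  exact hsurj.countable

/-! ### Stopped means for a randomized stopping time -/

lemma measurable_stoppedPosition {Γ Ω : Type*} [MeasurableSpace Γ] [MeasurableSpace Ω]
    {τ : (ℕ → Γ) × Ω → ℕ∞} (hτ : Measurable τ) :
    Measurable fun p : (ℕ → Γ) × Ω => p.1 (τ p).toNat := by
  have heval : Measurable fun q : (ℕ → Γ) × ℕ => q.1 q.2 :=
    measurable_from_prod_countable_left fun n => measurable_pi_apply n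
  have hn : Measurable fun p => (τ p).toNat := (Measurable.of_discrete (f := ENat.toNat)).comp hτ
  exact heval.comp (measurable_fst.prodMk hn)

/-- The set of `ω` for which the stopping time is almost surely zero. Since this is decided by the
starting point of the path, it is enough to evaluate at the constant path. -/
def zeroStopSet {Γ Ω : Type*} [Group Γ] (τ : (ℕ → Γ) × Ω → ℕ∞) : Set Ω :=
  {ω | τ (fun _ => 1, ω) = 0}

lemma measurableSet_zeroStopSet {Γ Ω : Type*} [Group Γ] [MeasurableSpace Γ] [MeasurableSpace Ω]
    {τ : (ℕ → Γ) × Ω → ℕ∞} (hτ : Measurable τ) : MeasurableSet (zeroStopSet τ) :=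
  (hτ.comp measurable_prodMk_left) (MeasurableSet.singleton 0)

lemma lintegral_indicator_add_indicator_compl {Ω : Type*} [MeasurableSpace Ω] {lam : Measure Ω}
    {Z : Set Ω} (hZ : MeasurableSet Z) (a b : ℝ≥0∞) :
    ∫⁻ ω, (Z.indicator (fun _ => a) ω + Zᶜ.indicator (fun _ => b) ω) ∂lam
      = lam Z * a + lam Zᶜ * b := by
  rw [lintegral_add_left (measurable_const.indicator hZ), lintegral_indicator_const hZ,
    lintegral_indicator_const hZ.compl, mul_comm a, mul_comm b]

section StoppedMass

variable {Γ Ω : Type*} [Group Γ] [MeasurableSpace Γ] [DiscreteMeasurableSpace Γ] [Countable Γ]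
  [MeasurableSpace Ω] {μ : Measure Γ} [IsProbabilityMeasure μ] {lam : Measure Ω}
  [IsProbabilityMeasure lam] {τ : (ℕ → Γ) × Ω → ℕ∞}

lemma tsum_mul_stoppedMass (hτ : Measurable τ) (hfin : ∀ᵐ p ∂(walkLaw μ).prod lam, τ p ≠ ⊤)
    (u : Γ → ℝ≥0∞) :
    ∑' h, u h * ENNReal.ofReal (stoppedMass μ lam τ h)
      = ∫⁻ p, u (p.1 (τ p).toNat) ∂(walkLaw μ).prod lam := by
  have hm := measurable_stoppedPosition hτ
  rw [← lintegral_map (f := u) .of_discrete hm, lintegral_countable']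
  congr 1
  funext h
  rw [Measure.map_apply hm (.of_discrete), stoppedMass, ofReal_measureReal]
  congr 1
  refine measure_congr ?_
  filter_upwards [hfin] with p hp
  obtain ⟨n, hn⟩ := ENat.ne_top_iff_exists.1 hp
  refine propext ?_
  change (∃ n : ℕ, τ p = n ∧ p.1 n = h) ↔ p.1 (τ p).toNat = h
  rw [← hn]
  simp

/-- The mean of `F` at the position of the walk from `g` at time `τ`. Where `τ` is infinite the
position is read at time `0`, which is immaterial for almost surely finite `τ`. -/
noncomputable def stoppedMean (μ : Measure Γ) (lam : Measure Ω) (τ : (ℕ → Γ) × Ω → ℕ∞)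
    (F : Γ → ℝ≥0∞) (g : Γ) : ℝ≥0∞ :=
  ∫⁻ p, F (g * p.1 (τ p).toNat) ∂(walkLaw μ).prod lam

lemma tsum_mul_convex_stoppedMass (hτ : Measurable τ)
    (hfin : ∀ᵐ p ∂(walkLaw μ).prod lam, τ p ≠ ⊤) {t : ℝ} (ht₀ : 0 ≤ t) (ht₁ : t ≤ 1)
    (F : Γ → ℝ≥0∞) (g : Γ) :
    ∑' h, F (g * h) * ENNReal.ofReal (t * μ.real {h} + (1 - t) * stoppedMass μ lam τ h)
      = ENNReal.ofReal t * stepOp μ F g + ENNReal.ofReal (1 - t) * stoppedMean μ lam τ F g := by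
  have h1 (h : Γ) : F (g * h) * ENNReal.ofReal (t * μ.real {h} + (1 - t) * stoppedMass μ lam τ h)
      = ENNReal.ofReal t * (F (g * h) * μ {h})
        + ENNReal.ofReal (1 - t) * (F (g * h) * ENNReal.ofReal (stoppedMass μ lam τ h)) := by
    have hs : 0 ≤ stoppedMass μ lam τ h := measureReal_nonneg
    have ht : 0 ≤ 1 - t := sub_nonneg.2 ht₁
    rw [ENNReal.ofReal_add (by positivity) (by positivity), ENNReal.ofReal_mul ht₀,
      ENNReal.ofReal_mul ht, ofReal_measureReal]
    ring
  simp only [h1]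
  rw [ENNReal.tsum_add, ENNReal.tsum_mul_left, ENNReal.tsum_mul_left,
    tsum_mul_stoppedMass hτ hfin fun h => F (g * h), stepOp, lintegral_countable' (μ := μ)]
  rfl

lemma stoppedMean_eq_lintegral (hτ : Measurable τ) (F : Γ → ℝ≥0∞) (g : Γ) :
    stoppedMean μ lam τ F g
      = ∫⁻ ω, ∫⁻ x, F (g * x (τ (x, ω)).toNat) ∂walkLaw μ ∂lam :=
  lintegral_prod_symm _ ((Measurable.of_discrete (f := fun y => F (g * y))).comp
    (measurable_stoppedPosition hτ)).aemeasurable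

lemma ae_ae_le {M : ℕ} (hτ : Measurable τ) (hb : ∀ᵐ p ∂(walkLaw μ).prod lam, τ p ≤ M) :
    ∀ᵐ ω ∂lam, ∀ᵐ x ∂walkLaw μ, τ (x, ω) ≤ M := by
  have hm : MeasurableSet {p | τ p ≤ M} := hτ (.of_discrete (s := Set.Iic (M : ℕ∞)))
  have := Measure.ae_ae_of_ae_prod hb
  exact (Measure.ae_ae_comm (p := fun x ω => τ (x, ω) ≤ M) hm).1 this

lemma stoppedMean_le (hτ : IsRandomizedStoppingTime τ) {k : ℕ}
    (hb : ∀ᵐ p ∂(walkLaw μ).prod lam, τ p ≤ (k + 1 : ℕ)) (F : Γ → ℝ≥0∞) (g : Γ) :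
    stoppedMean μ lam τ F g ≤ lam (zeroStopSet τ) * F g
      + lam (zeroStopSet τ)ᶜ * stepOp μ (upperEnvelope μ F k) g := by
  rw [stoppedMean_eq_lintegral hτ.measurable,
    ← lintegral_indicator_add_indicator_compl (measurableSet_zeroStopSet hτ.measurable)]
  refine lintegral_mono_ae ?_
  filter_upwards [ae_ae_le hτ.measurable hb] with ω hω
  by_cases h : ω ∈ zeroStopSet τ
  · simpa [h] using (lintegral_stopped_of_eq_zero (hτ.isStoppingTime ω) h F g).le
  · simpa [h] using (lintegral_stopped_mem_Icc (hτ.isStoppingTime ω) h F g hω).2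

lemma le_stoppedMean (hτ : IsRandomizedStoppingTime τ) {k : ℕ}
    (hb : ∀ᵐ p ∂(walkLaw μ).prod lam, τ p ≤ (k + 1 : ℕ)) (F : Γ → ℝ≥0∞) (g : Γ) :
    lam (zeroStopSet τ) * F g + lam (zeroStopSet τ)ᶜ * stepOp μ (lowerEnvelope μ F k) g
      ≤ stoppedMean μ lam τ F g := by
  rw [stoppedMean_eq_lintegral hτ.measurable,
    ← lintegral_indicator_add_indicator_compl (measurableSet_zeroStopSet hτ.measurable)]
  refine lintegral_mono_ae ?_
  filter_upwards [ae_ae_le hτ.measurable hb] with ω hω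
  by_cases h : ω ∈ zeroStopSet τ
  · simpa [h] using (lintegral_stopped_of_eq_zero (hτ.isStoppingTime ω) h F g).ge
  · simpa [h] using (lintegral_stopped_mem_Icc (hτ.isStoppingTime ω) h F g hω).1

/-- Optional stopping for harmonic functions. -/
lemma stoppedMean_eq_of_stepOp_eq (hτ : IsRandomizedStoppingTime τ) {k : ℕ}
    (hb : ∀ᵐ p ∂(walkLaw μ).prod lam, τ p ≤ (k + 1 : ℕ)) {F : Γ → ℝ≥0∞}
    (hF : ∀ g, stepOp μ F g = F g) (g : Γ) : stoppedMean μ lam τ F g = F g := by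
  have hu := stoppedMean_le hτ hb F g
  have hl := le_stoppedMean hτ hb F g
  rw [upperEnvelope_eq_of_stepOp_eq hF] at hu
  rw [lowerEnvelope_eq_of_stepOp_eq hF] at hl
  rw [hF, ← add_mul, prob_add_prob_compl (measurableSet_zeroStopSet hτ.measurable), one_mul]
    at hu hl
  exact le_antisymm hu hl

/-- The atom of `τ` at zero is removed by conditioning: with `p` its mass and `c = 1 - b * p`, the
weights `a / c` and `b * (1 - p) / c` again sum to one. -/
lemma IsStoppingBalanced.of_stoppedMean (hτ : IsRandomizedStoppingTime τ) {k : ℕ}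
    (hb : ∀ᵐ p ∂(walkLaw μ).prod lam, τ p ≤ (k + 1 : ℕ)) {F : Γ → ℝ≥0∞} (hfin : ∀ g, F g ≠ ∞)
    {a b : ℝ≥0} (hab : a + b = 1) (ha : 0 < a)
    (hF : ∀ g, a * stepOp μ F g + b * stoppedMean μ lam τ F g = F g) :
    ∃ t s : ℝ≥0, t + s = 1 ∧ 0 < t ∧ IsStoppingBalanced μ t s k F := by
  obtain ⟨p, hp⟩ : ∃ p : ℝ≥0, (p : ℝ≥0∞) = lam (zeroStopSet τ) :=
    ⟨_, ENNReal.coe_toNNReal (measure_ne_top _ _)⟩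
  obtain ⟨q, hq⟩ : ∃ q : ℝ≥0, (q : ℝ≥0∞) = lam (zeroStopSet τ)ᶜ :=
    ⟨_, ENNReal.coe_toNNReal (measure_ne_top _ _)⟩
  have hpq : p + q = 1 := by
    have := prob_add_prob_compl (μ := lam) (measurableSet_zeroStopSet hτ.measurable)
    rw [← hp, ← hq] at this
    exact_mod_cast this
  set c := a + b * q with hc
  have hc0 : 0 < c := by positivity
  have hcp : c + b * p = 1 := by rw [← hab, hc]; linear_combination b * hpq
  have hF' (g : Γ) : F g = c * F g + b * p * F g := by
    rw [← add_mul]; norm_cast; rw [hcp]; simp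
  have hne (g : Γ) : (b * p * F g : ℝ≥0∞) ≠ ∞ := ENNReal.mul_ne_top (by finiteness) (hfin g)
  have hdiv (g : Γ) (v : ℝ≥0∞) : ((a / c : ℝ≥0) : ℝ≥0∞) * stepOp μ F g + (b * q / c : ℝ≥0) * v
      = (c : ℝ≥0∞)⁻¹ * (a * stepOp μ F g + b * q * v) := by
    rw [ENNReal.coe_div hc0.ne', ENNReal.coe_div hc0.ne']
    push_cast
    rw [div_eq_mul_inv, div_eq_mul_inv]
    ring
  have hcinv (g : Γ) : (c : ℝ≥0∞)⁻¹ * (c * F g) = F g := by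
    rw [← mul_assoc, ENNReal.inv_mul_cancel (by exact_mod_cast hc0.ne') ENNReal.coe_ne_top, one_mul]
  refine ⟨a / c, b * q / c, ?_, div_pos ha hc0, ⟨fun g => ?_, fun g => ?_⟩⟩
  · rw [← add_div, ← hc, div_self hc0.ne']
  · rw [hdiv]
    conv_rhs => rw [← hcinv g]
    gcongr
    refine (ENNReal.add_le_add_iff_right (hne g)).1 ?_
    rw [← hF' g]
    calc a * stepOp μ F g + b * q * stepOp μ (lowerEnvelope μ F k) g + b * p * F g
        = a * stepOp μ F g + b * (p * F g + q * stepOp μ (lowerEnvelope μ F k) g) := by ring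
      _ ≤ a * stepOp μ F g + b * stoppedMean μ lam τ F g := by
        gcongr; rw [hp, hq]; exact le_stoppedMean hτ hb F g
      _ = F g := hF g
  · rw [hdiv]
    conv_lhs => rw [← hcinv g]
    gcongr
    refine (ENNReal.add_le_add_iff_right (hne g)).1 ?_
    rw [← hF' g]
    calc F g = a * stepOp μ F g + b * stoppedMean μ lam τ F g := (hF g).symm
      _ ≤ a * stepOp μ F g + b * (p * F g + q * stepOp μ (upperEnvelope μ F k) g) := by
        gcongr; rw [hp, hq]; exact stoppedMean_le hτ hb F g
      _ = a * stepOp μ F g + b * q * stepOp μ (upperEnvelope μ F k) g + b * p * F g := by ring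

end StoppedMass

/-! ### Equality of the cones of harmonic functions -/

theorem theorem1 {Γ Ω : Type*} [Group Γ] [MeasurableSpace Γ] [DiscreteMeasurableSpace Γ]
    [MeasurableSpace Ω] (μ : Measure Γ) [IsProbabilityMeasure μ] (hμ : IsGenerating μ)
    (lam : Measure Ω) [IsProbabilityMeasure lam]
    (τ : (ℕ → Γ) × Ω → ℕ∞) (hτ : IsRandomizedStoppingTime τ)
    (hbdd : ∃ M : ℕ, ∀ᵐ p ∂((walkLaw μ).prod lam), τ p ≤ M)
    (t : ℝ) (ht₀ : 0 < t) (ht₁ : t ≤ 1) :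
    positiveHarmonic (fun g => μ.real {g}) =
      positiveHarmonic (fun g => t * μ.real {g} + (1 - t) * stoppedMass μ lam τ g) := by
  have : Countable Γ := hμ.countable
  obtain ⟨M, hM⟩ := hbdd
  have hfin : ∀ᵐ p ∂(walkLaw μ).prod lam, τ p ≠ ⊤ := by
    filter_upwards [hM] with p hp
    exact ne_top_of_le_ne_top (ENat.natCast_ne_top M) hp
  -- the horizon `M + 1` is taken so that it is at least one
  have hb : ∀ᵐ p ∂(walkLaw μ).prod lam, τ p ≤ (M + 1 + 1 : ℕ) := by
    filter_upwards [hM] with p hp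
    exact hp.trans (by exact_mod_cast (by omega : M ≤ M + 1 + 1))
  have hmass (g : Γ) : 0 ≤ t * μ.real {g} + (1 - t) * stoppedMass μ lam τ g := by
    have hs : 0 ≤ stoppedMass μ lam τ g := measureReal_nonneg
    have ht : 0 ≤ 1 - t := sub_nonneg.2 ht₁
    positivity
  have hsum : t.toNNReal + (1 - t).toNNReal = 1 := by
    rw [← Real.toNNReal_add ht₀.le (sub_nonneg.2 ht₁)]
    simp
  ext f
  refine and_congr_right fun hf => ?_
  rw [isHarmonic_iff_tsum_ofReal (fun _ => measureReal_nonneg) hf,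
    isHarmonic_iff_tsum_ofReal hmass hf]
  set F : Γ → ℝ≥0∞ := fun g => ENNReal.ofReal (f g)
  have hμsum (g : Γ) : ∑' h, F (g * h) * ENNReal.ofReal (μ.real {h}) = stepOp μ F g := by
    rw [stepOp, lintegral_countable']
    exact tsum_congr fun h => by rw [ofReal_measureReal]
  have hθsum (g : Γ) := tsum_mul_convex_stoppedMass hτ.measurable hfin ht₀.le ht₁ F g
  change (∀ g, ∑' h, F (g * h) * ENNReal.ofReal (μ.real {h}) = F g) ↔ (∀ g, ∑' h, F (g * h) *
    ENNReal.ofReal (t * μ.real {h} + (1 - t) * stoppedMass μ lam τ h) = F g)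
  simp only [hμsum, hθsum]
  constructor
  · intro hF g
    rw [hF, stoppedMean_eq_of_stepOp_eq hτ hb hF, ← add_mul]
    change ((t.toNNReal : ℝ≥0∞) + ((1 - t).toNNReal : ℝ≥0∞)) * F g = F g
    rw [← ENNReal.coe_add, hsum]
    simp
  · intro hF
    obtain ⟨t', s', hts, ht', hbal⟩ := IsStoppingBalanced.of_stoppedMean hτ hb
      (fun g => ENNReal.ofReal_ne_top) hsum (Real.toNNReal_pos.2 ht₀) hF
    exact hbal.stepOp_eq hts ht' (by omega) fun g => ENNReal.ofReal_ne_top
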